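/- A family $e_1,\dots,e_k$ of complex $n\times n$ matrices is called anticommuting if $e_ie_j=-e_je_i$ for all distinct $i,j\in\{1,\dots,k\}$. For an integer $n\ge 1$, let $\alpha(n)$ denote the largest $k$ for which there exists an anticommuting family $e_1,\dots,e_k\in\mathbb{C}^{n\times n}$ with $e_1^2,\dots,e_k^2\neq 0$. Then this maximum exists for every $n\ge 1$, and \[ \alpha(n)=\begin{cases}2n-1, & \text{if } n\in\{1,2\},\\ 2n-2, & \text{if } n\in\{3,4\},\\ 2n-3, & \text{if } n>4.\end{cases} \] -/

import Mathlib

/-- A family of square matrices is anticommuting if any two members with distinct indices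
anticommute. -/
def IsAnticommuting {ι : Type*} {n : ℕ} (e : ι → Matrix (Fin n) (Fin n) ℂ) : Prop :=
  ∀ i j : ι, i ≠ j → e i * e j = -(e j * e i)

/-- The set of all `k` for which there is an anticommuting family of `k` complex `n × n` matrices,
each of which has a nonzero square. -/
def anticommutingSizes (n : ℕ) : Set ℕ :=
  {k | ∃ e : Fin k → Matrix (Fin n) (Fin n) ℂ, IsAnticommuting e ∧ ∀ i, e i ^ 2 ≠ 0}

/-- The largest size of an anticommuting family of complex `n × n` matrices with nonzero squares.
(That the supremum is a genuine maximum is part of the theorem.) -/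
noncomputable def anticommutingAlpha (n : ℕ) : ℕ :=
  sSup (anticommutingSizes n)

open Module

/-! The upper bound is by strong induction on the dimension `n`. Choose an eigenvalue `c i` of each
`e i`. The operator `e i ^ 2 - c i ^ 2` is singular and commutes with the whole family. If it is not
nilpotent, its Fitting decomposition splits the family, and superadditivity of the bound suffices
(`card_le_of_commute`). Otherwise `e i` has no eigenvalues besides `± c i`. If `c a` and `c b` are
nonzero for some `a ≠ b`, then `e b` exchanges the two generalized eigenspaces of `e a`, and the
products `e b * e i` form a family of two fewer members in at most half the dimension
(`card_le_of_injective`).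

In the remaining case at most one member is not nilpotent. The nilpotent ones number at most `2 * n
- 4` if there are any (`card_add_four_le_of_isNilpotent`): a generic matrix coefficient turns them
into a skew pairing of vectors and covectors, and common kernel vectors on both sides remove two
dimensions.

The bound is attained by block sums of Pauli-type matrices for `n ≤ 4`, and by `2 * (n - 2)`
nilpotents with one diagonal involution for `n > 4`. -/

/-- The members of `e` indexed by `s` pairwise anticommute and have nonzero squares. -/
structure IsAnticommutingOn {ι K V : Type*} [Field K] [AddCommGroup V] [Module K V]
    (e : ι → End K V) (s : Finset ι) : Prop where
  anticomm : ∀ i ∈ s, ∀ j ∈ s, i ≠ j → ∀ x, e i (e j x) = -e j (e i x)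
  sq_ne_zero : ∀ i ∈ s, ∃ x, e i (e i x) ≠ 0

/-! ### Nilpotent families and skew pairings -/

section Nilpotent

variable {ι K V : Type*} [Field K] [AddCommGroup V] [Module K V]

/-- Pairwise anticommuting nilpotent endomorphisms have a common kernel vector in each nonzero
invariant subspace. -/
theorem exists_common_kernel_vector {e : ι → End K V} {s : Finset ι}
    (he : ∀ i ∈ s, ∀ j ∈ s, i ≠ j → ∀ x, e i (e j x) = -e j (e i x))
    (t : Finset ι) (hts : t ⊆ s) (hnil : ∀ i ∈ t, IsNilpotent (e i)) (W : Submodule K V)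
    (hW : ∀ i ∈ s, ∀ x ∈ W, e i x ∈ W) (hW0 : W ≠ ⊥) :
    ∃ x ∈ W, x ≠ 0 ∧ ∀ i ∈ t, e i x = 0 := by
  classical
  induction t using Finset.induction_on generalizing W with
  | empty =>
    obtain ⟨x, hx, hx0⟩ := W.ne_bot_iff.mp hW0
    exact ⟨x, hx, hx0, by simp⟩
  | insert a t ha ih =>
    have has : a ∈ s := hts (Finset.mem_insert_self a t)
    -- By anticommutation `W ⊓ ker (e a)` is again invariant under the family, so once it is nonzero
    -- the induction continues inside it.
    have hker : W ⊓ LinearMap.ker (e a) ≠ ⊥ := by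
      obtain ⟨x, hx, hx0⟩ := W.ne_bot_iff.mp hW0
      obtain ⟨m, hm⟩ := hnil a (Finset.mem_insert_self a t)
      have hex : ∃ m, (e a ^ m) x = 0 := ⟨m, by simp [hm]⟩
      have hpow : ∀ m, (e a ^ m) x ∈ W := by
        intro m
        induction m with
        | zero => simpa using hx
        | succ m ihm => rw [pow_succ']; exact hW a has _ ihm
      have hfind := Nat.find_spec hex
      obtain ⟨r, hr⟩ : ∃ r, Nat.find hex = r + 1 := by
        refine Nat.exists_eq_succ_of_ne_zero fun h0 => hx0 ?_
        simpa [h0] using hfind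
      rw [hr, pow_succ'] at hfind
      exact (Submodule.ne_bot_iff _).mpr
        ⟨(e a ^ r) x, ⟨hpow r, hfind⟩, Nat.find_min hex (by omega)⟩
    obtain ⟨x, hx, hx0, hxt⟩ := ih (fun i hi => hts (Finset.mem_insert_of_mem hi))
      (fun i hi => hnil i (Finset.mem_insert_of_mem hi)) (W ⊓ LinearMap.ker (e a))
      (fun i hi x hx => ⟨hW i hi x hx.1, by
        have hx2 : e a x = 0 := hx.2
        by_cases hia : i = a
        · subst hia; simp [hx2]
        · simp [he a has i hi (Ne.symm hia) x, hx2]⟩) hker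
    refine ⟨x, hx.1, hx0, fun i hi => ?_⟩
    rcases Finset.mem_insert.mp hi with rfl | hi
    · exact hx.2
    · exact hxt i hi

/-- Vectors and covectors whose pairing matrix has nonzero diagonal and is skew-symmetric off the
diagonal. -/
structure IsSkewPairing (a : ι → V) (b : ι → Dual K V) (s : Finset ι) : Prop where
  skew : ∀ i ∈ s, ∀ j ∈ s, i ≠ j → b i (a j) = -b j (a i)
  diag_ne_zero : ∀ i ∈ s, b i (a i) ≠ 0

/-- For the symmetric form `⟨(a, b), (a', b')⟩ = b a' + b' a` on `V × Dual K V`, the pairs `(a i, b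
i)` are orthogonal and non-isotropic, hence independent in a space of dimension `2 * finrank K V`.
-/
theorem IsSkewPairing.card_le [CharZero K] [FiniteDimensional K V] {a : ι → V} {b : ι → Dual K V}
    {s : Finset ι} (h : IsSkewPairing a b s) : s.card ≤ 2 * finrank K V := by
  have hli : LinearIndependent K (fun i : s => (a i, b i)) := by
    rw [Fintype.linearIndependent_iff]
    intro c hc l
    have h1 := congrArg (fun p => b l p.1) hc
    have h2 := congrArg (fun p => p.2 (a l)) hc
    simp only [Prod.fst_sum, Prod.snd_sum, Prod.smul_fst, Prod.smul_snd, map_sum, map_smul,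
      Prod.fst_zero, Prod.snd_zero, map_zero, LinearMap.zero_apply, LinearMap.sum_apply,
      LinearMap.smul_apply, smul_eq_mul] at h1 h2
    have h3 : ∑ i : s, c i * (b l (a i) + b i (a l)) = 0 := by
      simp only [mul_add, Finset.sum_add_distrib, h1, h2, add_zero]
    rw [Finset.sum_eq_single l] at h3
    · have h4 : b l (a l) + b l (a l) ≠ 0 := by
        rw [← two_mul]; exact mul_ne_zero two_ne_zero (h.diag_ne_zero l l.2)
      exact (mul_eq_zero.mp h3).resolve_right h4
    · intro i _ hi
      rw [h.skew l l.2 i i.2 (fun hli => hi (Subtype.ext hli.symm))]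
      simp
    · simp
  have := hli.fintype_card_le_finrank
  rw [Module.finrank_prod, Subspace.dual_finrank_eq, Fintype.card_coe] at this
  omega

/-- The pairing descends to the quotient by the line through `x`. -/
theorem IsSkewPairing.card_add_two_le [CharZero K] [FiniteDimensional K V] {a : ι → V}
    {b : ι → Dual K V} {s : Finset ι} (h : IsSkewPairing a b s) {x : V} (hx : x ≠ 0)
    (hbx : ∀ i ∈ s, b i x = 0) : s.card + 2 ≤ 2 * finrank K V := by
  classical
  let W := K ∙ x
  have hle : ∀ i ∈ s, W ≤ LinearMap.ker (b i) := fun i hi => by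
    rw [Submodule.span_singleton_le_iff_mem]; exact hbx i hi
  let b' : ι → Dual K (V ⧸ W) := fun i => if hi : i ∈ s then W.liftQ (b i) (hle i hi) else 0
  have hb' : ∀ i ∈ s, ∀ y, b' i (W.mkQ y) = b i y := fun i hi y => by simp [b', hi]
  have h' : IsSkewPairing (fun i => W.mkQ (a i)) b' s :=
    ⟨fun i hi j hj hij => by rw [hb' i hi, hb' j hj]; exact h.skew i hi j hj hij,
      fun i hi => by rw [hb' i hi]; exact h.diag_ne_zero i hi⟩
  have h1 := h'.card_le
  have h2 := W.finrank_quotient_add_finrank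
  have h3 : finrank K W = 1 := finrank_span_singleton hx
  omega

/-- The pairing restricts to `ker φ`, which still contains `x`, so a second dimension is saved. -/
theorem IsSkewPairing.card_add_four_le [CharZero K] [FiniteDimensional K V] {a : ι → V}
    {b : ι → Dual K V} {s : Finset ι} (h : IsSkewPairing a b s) {x : V} (hx : x ≠ 0)
    (hbx : ∀ i ∈ s, b i x = 0) {φ : Dual K V} (hφ : φ ≠ 0) (hφa : ∀ i ∈ s, φ (a i) = 0)
    (hφx : φ x = 0) : s.card + 4 ≤ 2 * finrank K V := by
  classical
  let a' : ι → LinearMap.ker φ := fun i => if hi : i ∈ s then ⟨a i, hφa i hi⟩ else 0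
  have ha' : ∀ i ∈ s, (a' i : V) = a i := fun i hi => by simp [a', hi]
  have h' : IsSkewPairing a' (fun i => (b i).domRestrict (LinearMap.ker φ)) s :=
    ⟨fun i hi j hj hij => by
        simp only [LinearMap.domRestrict_apply, ha' i hi, ha' j hj]; exact h.skew i hi j hj hij,
      fun i hi => by
        simp only [LinearMap.domRestrict_apply, ha' i hi]; exact h.diag_ne_zero i hi⟩
  have h1 := h'.card_add_two_le (x := ⟨x, hφx⟩) (fun h0 => hx (congrArg Subtype.val h0)) hbx
  have h2 := Module.Dual.finrank_ker_add_one_of_ne_zero hφ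
  omega

/-- Finitely many nonzero endomorphisms have a common nonvanishing matrix coefficient. -/
theorem exists_forall_matrixCoeff_ne_zero [Infinite K] {T : ι → End K V} {s : Finset ι}
    (hT : ∀ i ∈ s, ∃ x, T i x ≠ 0) : ∃ (u : Dual K V) (v : V), ∀ i ∈ s, u (T i v) ≠ 0 := by
  -- Over an infinite field finitely many proper subspaces do not cover `V`.
  obtain ⟨v, hv⟩ := Submodule.exists_forall_notMem_of_forall_ne_top
    (fun i : s => LinearMap.ker (T i)) (fun i h => by
      obtain ⟨x, hx⟩ := hT i i.2
      exact hx (LinearMap.mem_ker.mp (h ▸ Submodule.mem_top)))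
  obtain ⟨u, hu⟩ := Module.exists_dual_forall_apply_ne_zero (K := K) (fun i : s => T i v) hv
  exact ⟨u, v, fun i hi => hu ⟨i, hi⟩⟩

theorem IsAnticommutingOn.card_add_four_le_of_isNilpotent [CharZero K] [FiniteDimensional K V]
    {e : ι → End K V} {s : Finset ι} (h : IsAnticommutingOn e s)
    (hnil : ∀ i ∈ s, IsNilpotent (e i)) (hs : s.Nonempty) : s.card + 4 ≤ 2 * finrank K V := by
  obtain ⟨k, hk⟩ := hs
  obtain ⟨w, hw⟩ := h.sq_ne_zero k hk
  -- Looking for `x` inside the sum of the ranges forces `φ x = 0` for every covector `φ` that kills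
  -- all ranges.
  let W : Submodule K V := ⨆ i ∈ s, LinearMap.range (e i)
  have hmem : ∀ i ∈ s, ∀ x, e i x ∈ W := fun i hi x =>
    Submodule.mem_iSup_of_mem i (Submodule.mem_iSup_of_mem hi ⟨x, rfl⟩)
  obtain ⟨x, hxW, hx0, hx⟩ := exists_common_kernel_vector h.anticomm s subset_rfl hnil W
    (fun i hi x _ => hmem i hi x)
    ((Submodule.ne_bot_iff _).mpr ⟨_, hmem k hk (e k w), hw⟩)
  obtain ⟨φ, -, hφ0, hφ⟩ := exists_common_kernel_vector (e := fun i => (e i).dualMap) (s := s)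
    (fun i hi j hj hij φ => by
      ext y
      simp [h.anticomm j hj i hi (Ne.symm hij) y]) s subset_rfl
    (fun i hi => by
      obtain ⟨m, hm⟩ := hnil i hi
      refine ⟨m, ?_⟩
      have hpow : ∀ m, ((e i).dualMap) ^ m = (e i ^ m).dualMap := by
        intro m
        induction m with
        | zero => ext; simp
        | succ m ihm => rw [pow_succ, ihm, pow_succ']; rfl
      rw [hpow, hm]; ext; simp) ⊤ (fun _ _ _ _ => trivial)
    (by
      intro htop
      have : Subsingleton (Dual K V) := (Submodule.subsingleton_iff K).mp
        (subsingleton_of_bot_eq_top htop.symm)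
      apply hw
      rw [← Module.forall_dual_apply_eq_zero_iff K]
      intro ψ
      rw [Subsingleton.elim ψ 0, LinearMap.zero_apply])
  have hφe : ∀ i ∈ s, ∀ y, φ (e i y) = 0 := fun i hi y => by
    simpa using LinearMap.congr_fun (hφ i hi) y
  have hφx : φ x = 0 := by
    have : W ≤ LinearMap.ker φ := by
      refine iSup₂_le fun i hi => ?_
      rintro _ ⟨y, rfl⟩
      exact hφe i hi y
    exact this hxW
  obtain ⟨u, v, huv⟩ := exists_forall_matrixCoeff_ne_zero (T := fun i => e i * e i) (s := s)
    (fun i hi => h.sq_ne_zero i hi)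
  have hp : IsSkewPairing (fun i => e i v) (fun i => u ∘ₗ e i) s :=
    ⟨fun i hi j hj hij => by simp [h.anticomm i hi j hj hij v], fun i hi => huv i hi⟩
  exact hp.card_add_four_le hx0 (fun i hi => by simp [hx i hi]) hφ0 (fun i hi => hφe i hi v) hφx

end Nilpotent

/-! ### Arithmetic of the bound, and a Bézout identity -/

/-- The claimed value of the largest size of an anticommuting family in dimension `n`. -/
def anticommutingBound (n : ℕ) : ℕ :=
  if n ≤ 2 then 2 * n - 1 else if n ≤ 4 then 2 * n - 2 else 2 * n - 3

theorem anticommutingBound_add_le (a b : ℕ) :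
    anticommutingBound a + anticommutingBound b ≤ anticommutingBound (a + b) := by
  unfold anticommutingBound
  split_ifs <;> omega

theorem anticommutingBound_add_two_le {d n : ℕ} (hd : 1 ≤ d) (hn : 2 * d ≤ n) :
    anticommutingBound d + 2 ≤ anticommutingBound n := by
  unfold anticommutingBound
  split_ifs <;> omega

/-- Bézout's identity for powers of `c + g` and `c - g`. -/
theorem exists_bezout_pow {K V : Type*} [Field K] [CharZero K] [AddCommGroup V]
    [Module K V] (g : End K V) {c : K} (hc : c ≠ 0) (m : ℕ) :
    ∃ A B : End K V, A * (algebraMap K _ c + g) ^ m + B * (algebraMap K _ c - g) ^ m = 1 ∧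
      (algebraMap K _ c + g) ^ m * A + (algebraMap K _ c - g) ^ m * B = 1 := by
  open Polynomial in
  have hcop : IsCoprime ((C c + X : K[X]) ^ m) ((C c - X) ^ m) := by
    refine IsCoprime.pow ⟨C (2 * c)⁻¹, C (2 * c)⁻¹, ?_⟩
    have h2 : (2 * c)⁻¹ * (2 * c) = 1 := inv_mul_cancel₀ (mul_ne_zero two_ne_zero hc)
    calc C (2 * c)⁻¹ * (C c + X) + C (2 * c)⁻¹ * (C c - X)
        = C (2 * c)⁻¹ * (2 * C c) := by ring
      _ = C ((2 * c)⁻¹ * (2 * c)) := by simp only [map_mul, map_ofNat]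
      _ = 1 := by rw [h2, map_one]
  obtain ⟨p, q, hpq⟩ := hcop
  refine ⟨Polynomial.aeval g p, Polynomial.aeval g q, ?_, ?_⟩
  · simpa using congrArg (Polynomial.aeval g) hpq
  · rw [mul_comm p, mul_comm q] at hpq
    simpa using congrArg (Polynomial.aeval g) hpq

/-! ### Upper bound by induction on the dimension -/

section UpperBound

universe u v w

/-- Anticommuting families with nonzero squares in dimension `d` have at most
`anticommutingBound d` members. -/
def HasAnticommutingBound (ι : Type v) (K : Type w) [Field K] (d : ℕ) : Prop :=
  ∀ (V : Type u) [AddCommGroup V] [Module K V] [FiniteDimensional K V] (e : ι → End K V)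
    (s : Finset ι), finrank K V = d → IsAnticommutingOn e s → s.card ≤ anticommutingBound d

variable {ι : Type v} {K : Type w} {V : Type u} [Field K] [AddCommGroup V] [Module K V]
  [FiniteDimensional K V]

theorem card_le_of_invariant {e : ι → End K V} {s : Finset ι}
    (he : ∀ i ∈ s, ∀ j ∈ s, i ≠ j → ∀ x, e i (e j x) = -e j (e i x)) {W : Submodule K V}
    (hB : HasAnticommutingBound.{u} ι K (finrank K W)) (hW : ∀ i ∈ s, ∀ x ∈ W, e i x ∈ W)
    (hsq : ∀ i ∈ s, ∃ x ∈ W, e i (e i x) ≠ 0) :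
    s.card ≤ anticommutingBound (finrank K W) := by
  classical
  let e' : ι → End K W := fun i => if hi : i ∈ s then (e i).restrict (hW i hi) else 0
  have he' : ∀ i ∈ s, ∀ x : W, (e' i x : V) = e i x := fun i hi x => by simp [e', hi]
  refine hB W e' s rfl ⟨fun i hi j hj hij x => Subtype.ext ?_, fun i hi => ?_⟩
  · simp only [he' i hi, he' j hj, Submodule.coe_neg]
    exact he i hi j hj hij x
  · obtain ⟨x, hx, hx0⟩ := hsq i hi
    refine ⟨⟨x, hx⟩, fun h0 => hx0 ?_⟩
    simpa only [he' i hi, Submodule.coe_zero] using congrArg Subtype.val h0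

/-- A non-nilpotent, non-injective endomorphism commuting with the family splits it. -/
theorem IsAnticommutingOn.card_le_of_commute {e : ι → End K V} {s : Finset ι} (h : IsAnticommutingOn e s)
    (hB : ∀ d < finrank K V, HasAnticommutingBound.{u} ι K d) {N : End K V}
    (hN : ∀ i ∈ s, Commute N (e i)) {x : V} (hx : x ≠ 0) (hNx : N x = 0)
    (hnil : ¬ IsNilpotent N) : s.card ≤ anticommutingBound (finrank K V) := by
  classical
  -- Fitting decomposition; `1 ≤ k` is what puts `x` in the kernel part.
  obtain ⟨k, hk, hk1⟩ := (N.eventually_isCompl_ker_pow_range_pow.and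
    (Filter.eventually_ge_atTop 1)).exists
  set A := LinearMap.ker (N ^ k) with hA
  set B := LinearMap.range (N ^ k) with hB'
  have hcomm : ∀ i ∈ s, ∀ y, (N ^ k) (e i y) = e i ((N ^ k) y) := fun i hi y =>
    LinearMap.congr_fun ((hN i hi).pow_left k).eq y
  have hAinv : ∀ i ∈ s, ∀ y ∈ A, e i y ∈ A := fun i hi y hy => by
    rw [hA, LinearMap.mem_ker] at hy ⊢
    rw [hcomm i hi, hy, map_zero]
  have hBinv : ∀ i ∈ s, ∀ y ∈ B, e i y ∈ B := by
    rintro i hi _ ⟨y, rfl⟩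
    exact ⟨e i y, hcomm i hi y⟩
  have hdim : finrank K A + finrank K B = finrank K V :=
    Submodule.finrank_add_eq_of_isCompl hk
  have hA0 : 0 < finrank K A := by
    have hxA : x ∈ A := by
      obtain ⟨r, rfl⟩ : ∃ r, k = r + 1 := ⟨k - 1, by omega⟩
      rw [hA, LinearMap.mem_ker, pow_succ, Module.End.mul_apply, hNx, map_zero]
    exact Submodule.one_le_finrank_iff.mpr ((Submodule.ne_bot_iff A).mpr ⟨x, hxA, hx⟩)
  have hB0 : 0 < finrank K B :=
    Submodule.one_le_finrank_iff.mpr fun h0 => hnil ⟨k, LinearMap.range_eq_bot.mp h0⟩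
  have h1 : (s.filter fun i => ∃ y ∈ A, e i (e i y) ≠ 0).card ≤ anticommutingBound (finrank K A) :=
    card_le_of_invariant
      (fun i hi j hj => h.anticomm i (Finset.mem_filter.mp hi).1 j (Finset.mem_filter.mp hj).1)
      (hB _ (by omega)) (fun i hi => hAinv i (Finset.mem_filter.mp hi).1)
      (fun i hi => (Finset.mem_filter.mp hi).2)
  have h2 : (s.filter fun i => ∃ y ∈ B, e i (e i y) ≠ 0).card ≤ anticommutingBound (finrank K B) :=
    card_le_of_invariant
      (fun i hi j hj => h.anticomm i (Finset.mem_filter.mp hi).1 j (Finset.mem_filter.mp hj).1)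
      (hB _ (by omega)) (fun i hi => hBinv i (Finset.mem_filter.mp hi).1)
      (fun i hi => (Finset.mem_filter.mp hi).2)
  -- Since `A ⊔ B = ⊤`, each square is nonzero on at least one summand.
  have h3 : s ⊆ (s.filter fun i => ∃ y ∈ A, e i (e i y) ≠ 0) ∪
      (s.filter fun i => ∃ y ∈ B, e i (e i y) ≠ 0) := by
    intro i hi
    rw [← Finset.filter_or, Finset.mem_filter]
    refine ⟨hi, ?_⟩
    by_contra! hcon
    obtain ⟨y, hy⟩ := h.sq_ne_zero i hi
    obtain ⟨p, hp, q, hq, rfl⟩ := Submodule.mem_sup.mp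
      (show y ∈ A ⊔ B from hk.sup_eq_top ▸ Submodule.mem_top)
    exact hy (by rw [map_add, map_add, hcon.1 p hp, hcon.2 q hq, add_zero])
  calc s.card ≤ _ := (Finset.card_le_card h3).trans (Finset.card_union_le _ _)
    _ ≤ _ := (add_le_add h1 h2).trans (anticommutingBound_add_le _ _)
    _ = _ := by rw [hdim]

/-- Two invertible members of the family, one of them with a single eigenvalue up to sign, allow
halving the dimension at the cost of two members. -/
theorem IsAnticommutingOn.card_le_of_injective [CharZero K] {e : ι → End K V} {s : Finset ι}
    (h : IsAnticommutingOn e s)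
    (hB : ∀ d < finrank K V, HasAnticommutingBound.{u} ι K d) {a b : ι} (ha : a ∈ s) (hb : b ∈ s)
    (hab : a ≠ b) {c : K} (hc : c ≠ 0) {x : V} (hx : x ≠ 0) (hax : e a x = c • x)
    (hnil : IsNilpotent (e a * e a - algebraMap K _ (c * c))) (hinj : Function.Injective (e b)) :
    s.card ≤ anticommutingBound (finrank K V) := by
  classical
  set P : End K V := algebraMap K _ c + e a with hP
  set Q : End K V := algebraMap K _ c - e a with hQ
  have hba : e b * e a = -(e a * e b) := by
    ext y; simpa using h.anticomm b hb a ha hab.symm y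
  have hcb : algebraMap K (End K V) c * e b = e b * algebraMap K (End K V) c :=
    Algebra.commutes c (e b)
  have hca : algebraMap K (End K V) c * e a = e a * algebraMap K (End K V) c :=
    Algebra.commutes c (e a)
  have hsemi : SemiconjBy (e b) Q P := by
    rw [SemiconjBy, hP, hQ, mul_sub, add_mul, hba, hcb, sub_neg_eq_add]
  have hPQ : Commute P Q := by
    rw [Commute, SemiconjBy, hP, hQ]; simp only [mul_sub, add_mul, sub_mul, mul_add, hca]; abel
  have hQP : Q * P = -(e a * e a - algebraMap K _ (c * c)) := by
    rw [hP, hQ, map_mul]; simp only [sub_mul, mul_add, hca]; abel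
  obtain ⟨m, hm⟩ : IsNilpotent (Q * P) := hQP ▸ hnil.neg
  rw [hPQ.symm.mul_pow] at hm
  obtain ⟨A, B, hAB, hAB'⟩ := exists_bezout_pow (e a) hc m
  rw [← hP, ← hQ] at hAB hAB'
  have hsemi' : ∀ y, e b ((Q ^ m) y) = (P ^ m) (e b y) := fun y =>
    LinearMap.congr_fun (hsemi.pow_right m).eq y
  -- `W` and `W'` are the generalized eigenspaces of `e a` for `c` and `-c`.
  set W := LinearMap.ker (Q ^ m) with hW
  set W' := LinearMap.ker (P ^ m) with hW'
  have hdisj : Disjoint W W' := by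
    rw [Submodule.disjoint_def]
    intro y hy hy'
    rw [hW, LinearMap.mem_ker] at hy
    rw [hW', LinearMap.mem_ker] at hy'
    simpa [hy, hy'] using (LinearMap.congr_fun hAB y).symm
  have hle : W.map (e b) ≤ W' := by
    rintro _ ⟨y, hy, rfl⟩
    rw [hW, SetLike.mem_coe, LinearMap.mem_ker] at hy
    rw [hW', LinearMap.mem_ker, ← hsemi', hy, map_zero]
  have hdim : 2 * finrank K W ≤ finrank K V := by
    have h1 := Submodule.finrank_add_finrank_le_of_disjoint hdisj
    have h2 := Submodule.finrank_mono hle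
    have h3 := (Submodule.equivMapOfInjective (e b) hinj W).finrank_eq
    omega
  have hpos : 1 ≤ finrank K W := by
    refine Submodule.one_le_finrank_iff.mpr ((Submodule.ne_bot_iff W).mpr ⟨x, ?_, hx⟩)
    have hQx : Q x = 0 := by simp [hQ, hax]
    have hm0 : m ≠ 0 := by
      rintro rfl
      exact hx (by simpa using LinearMap.congr_fun hm x)
    obtain ⟨r, rfl⟩ := Nat.exists_eq_succ_of_ne_zero hm0
    rw [hW, LinearMap.mem_ker, pow_succ, Module.End.mul_apply, hQx, map_zero]
  have hmem : ∀ i ∈ (s.erase a).erase b, i ∈ s ∧ i ≠ a ∧ i ≠ b := fun i hi => by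
    simp only [Finset.mem_erase] at hi; tauto
  have hsw : ∀ i ∈ (s.erase a).erase b, ∀ y, e i (e b y) = -e b (e i y) := fun i hi =>
    h.anticomm i (hmem i hi).1 b hb (hmem i hi).2.2
  have hcard : ((s.erase a).erase b).card ≤ anticommutingBound (finrank K W) := by
    -- Two sign changes cancel, so `e b * e i` commutes with `e a` and preserves `W`; its square is
    -- `-(e b ^ 2 * e i ^ 2)`.
    refine card_le_of_invariant (e := fun i => e b * e i) ?_ (hB _ (by omega)) ?_ ?_
    · intro i hi j hj hij y
      simp only [Module.End.mul_apply, hsw i hi, hsw j hj,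
        h.anticomm i (hmem i hi).1 j (hmem j hj).1 hij y, map_neg]
    · intro i hi y hy
      have hcomm : Commute (e b * e i) Q := by
        have h1 : e i * e a = -(e a * e i) := by
          ext y; simpa using h.anticomm i (hmem i hi).1 a ha (hmem i hi).2.1 y
        have h2 : Commute (e b * e i) (e a) := by
          rw [Commute, SemiconjBy, mul_assoc, h1, mul_neg, ← mul_assoc, hba, neg_mul, neg_neg,
            mul_assoc]
        exact Commute.sub_right (Algebra.commutes c (e b * e i)).symm h2
      rw [hW, LinearMap.mem_ker] at hy ⊢
      have := LinearMap.congr_fun (hcomm.pow_right m).eq y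
      rw [Module.End.mul_apply, hy, map_zero] at this
      exact this.symm
    · intro i hi
      by_contra! hcon
      have hzero : ∀ y ∈ W, e i (e i y) = 0 := fun y hy => by
        have h1 := hcon y hy
        simp only [Module.End.mul_apply, hsw i hi, map_neg, neg_eq_zero] at h1
        exact (map_eq_zero_iff _ hinj).mp ((map_eq_zero_iff _ hinj).mp h1)
      have hrange : ∀ y, e i (e i ((P ^ m) y)) = 0 := fun y =>
        hzero _ (by rw [hW, LinearMap.mem_ker]; exact LinearMap.congr_fun hm y)
      -- Vanishing of `e i ^ 2` transfers from the range of `P ^ m` to that of `Q ^ m`, because `e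
      -- b` is injective, commutes with `e i ^ 2` and intertwines `Q ^ m` with `P ^ m`. By Bézout
      -- the two ranges span `V`.
      have hrange' : ∀ y, e i (e i ((Q ^ m) y)) = 0 := fun y => by
        refine (map_eq_zero_iff _ hinj).mp ?_
        have h1 := hrange (e b y)
        rwa [← hsemi', hsw i hi, map_neg, hsw i hi, neg_neg] at h1
      obtain ⟨y, hy⟩ := h.sq_ne_zero i (hmem i hi).1
      refine hy ?_
      have h1 : y = (P ^ m) (A y) + (Q ^ m) (B y) := (LinearMap.congr_fun hAB' y).symm
      rw [h1, map_add, map_add, hrange, hrange', add_zero]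
  have h1 := anticommutingBound_add_two_le hpos hdim
  rw [Finset.card_erase_of_mem (Finset.mem_erase.mpr ⟨hab.symm, hb⟩),
    Finset.card_erase_of_mem ha] at hcard
  omega

theorem hasAnticommutingBound [IsAlgClosed K] [CharZero K] (n : ℕ) :
    HasAnticommutingBound.{u} ι K n := by
  classical
  induction n using Nat.strong_induction_on with
  | _ n ih =>
  intro V _ _ _ e s hn h
  subst hn
  rcases s.eq_empty_or_nonempty with rfl | ⟨k, hk⟩
  · simp
  obtain ⟨w, hw⟩ := h.sq_ne_zero k hk
  have hnt : Nontrivial V := ⟨_, _, hw⟩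
  have hpos : 0 < finrank K V := finrank_pos
  have heig : ∀ i, ∃ c : K, ∃ x : V, x ≠ 0 ∧ e i x = c • x := fun i => by
    obtain ⟨c, hc⟩ := Module.End.exists_eigenvalue (e i)
    obtain ⟨x, hx⟩ := hc.exists_hasEigenvector
    exact ⟨c, x, hx.2, hx.apply_eq_smul⟩
  choose c x hx hcx using heig
  by_cases hsplit : ∃ i ∈ s, ¬ IsNilpotent (e i * e i - algebraMap K _ (c i * c i))
  · obtain ⟨i, hi, hnil⟩ := hsplit
    refine h.card_le_of_commute ih (fun j hj => ?_) (hx i) (x := x i) ?_ hnil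
    · refine Commute.sub_left ?_ (Algebra.commutes _ _)
      by_cases hij : i = j
      · subst hij
        exact (Commute.refl _).mul_left (Commute.refl _)
      · ext y
        simp [h.anticomm i hi j hj hij]
    · simp [hcx, smul_smul]
  push Not at hsplit
  have hzero : ∀ i ∈ s, c i = 0 → IsNilpotent (e i) := fun i hi hci => by
    obtain ⟨m, hm⟩ := hsplit i hi
    rw [hci, mul_zero, map_zero, sub_zero, ← pow_two, ← pow_mul] at hm
    exact ⟨_, hm⟩
  have hinj : ∀ i ∈ s, c i ≠ 0 → Function.Injective (e i) := fun i hi hci => by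
    refine (injective_iff_map_eq_zero (e i)).mpr fun y hy => ?_
    by_contra hy0
    obtain ⟨m, hm⟩ := hsplit i hi
    -- A kernel vector of `e i` would be an eigenvector of this nilpotent operator for the nonzero
    -- value `-(c i * c i)`.
    have hpow : ∀ m, ((e i * e i - algebraMap K (End K V) (c i * c i)) ^ m) y
        = (-(c i * c i)) ^ m • y := by
      intro m
      induction m with
      | zero => simp
      | succ m ihm =>
        have hy1 : (e i * e i - algebraMap K (End K V) (c i * c i)) y = (-(c i * c i)) • y := by
          rw [LinearMap.sub_apply, Module.End.mul_apply, hy, map_zero, zero_sub,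
            Module.algebraMap_end_apply, neg_smul]
        rw [pow_succ, Module.End.mul_apply, hy1, map_smul, ihm, smul_smul, ← pow_succ']
    have h1 := hpow m
    rw [hm, LinearMap.zero_apply, eq_comm, smul_eq_zero] at h1
    exact h1.elim (pow_ne_zero m (neg_ne_zero.mpr (mul_ne_zero hci hci))) hy0
  by_cases htwo : ∃ a ∈ s, ∃ b ∈ s, a ≠ b ∧ c a ≠ 0 ∧ c b ≠ 0
  · obtain ⟨a, ha, b, hb, hab, hca, hcb⟩ := htwo
    exact h.card_le_of_injective ih ha hb hab hca (hx a) (hcx a) (hsplit a ha) (hinj b hb hcb)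
  push Not at htwo
  have hcard : s.card ≤ (s.filter fun i => c i = 0).card + 1 := by
    have h1 : (s.filter fun i => ¬ c i = 0).card ≤ 1 := by
      refine Finset.card_le_one.mpr fun a ha b hb => ?_
      rw [Finset.mem_filter] at ha hb
      by_contra hab
      exact hb.2 (htwo a ha.1 b hb.1 hab ha.2)
    have h2 := Finset.card_filter_add_card_filter_not (s := s) (fun i => c i = 0)
    omega
  rcases (s.filter fun i => c i = 0).eq_empty_or_nonempty with h0 | h0
  · rw [h0, Finset.card_empty] at hcard
    unfold anticommutingBound
    split_ifs <;> omega
  · have h4 := IsAnticommutingOn.card_add_four_le_of_isNilpotent (e := e)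
      (s := s.filter fun i => c i = 0)
      ⟨fun i hi j hj => h.anticomm i (Finset.mem_filter.mp hi).1 j (Finset.mem_filter.mp hj).1,
        fun i hi => h.sq_ne_zero i (Finset.mem_filter.mp hi).1⟩
      (fun i hi => hzero i (Finset.mem_filter.mp hi).1 (Finset.mem_filter.mp hi).2) h0
    unfold anticommutingBound
    split_ifs <;> omega

end UpperBound

/-! ### Constructions attaining the bound -/

section LowerBound

theorem IsAnticommutingOn.card_mem_anticommutingSizes {V κ : Type*} [AddCommGroup V] [Module ℂ V]
    [FiniteDimensional ℂ V] [Fintype κ] {e : κ → End ℂ V}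
    (h : IsAnticommutingOn e Finset.univ) {n k : ℕ} (hn : finrank ℂ V = n)
    (hk : Fintype.card κ = k) : k ∈ anticommutingSizes n := by
  subst hk
  let E := LinearMap.toMatrixAlgEquiv (finBasisOfFinrankEq ℂ V hn)
  let f := (Fintype.equivFin κ).symm
  refine ⟨fun i => E (e (f i)), fun i j hij => ?_, fun i h0 => ?_⟩
  · rw [← map_mul, ← map_mul, ← map_neg]
    congr 1
    ext x
    exact h.anticomm _ (Finset.mem_univ _) _ (Finset.mem_univ _) (f.injective.ne hij) x
  · obtain ⟨x, hx⟩ := h.sq_ne_zero (f i) (Finset.mem_univ _)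
    rw [← map_pow, map_eq_zero_iff E E.injective, pow_two] at h0
    exact hx (LinearMap.congr_fun h0 x)

theorem isAnticommutingOn_toLin' {n : ℕ} {κ : Type*} {e : κ → Matrix (Fin n) (Fin n) ℂ}
    (he : IsAnticommuting e) (hsq : ∀ i, e i ^ 2 ≠ 0) (s : Finset κ) :
    IsAnticommutingOn (fun i => Matrix.toLin' (e i)) s := by
  refine ⟨fun i _ j _ hij x => ?_, fun i _ => ?_⟩
  · rw [← Matrix.toLin'_mul_apply, ← Matrix.toLin'_mul_apply, he i j hij, map_neg,
      LinearMap.neg_apply]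
  · by_contra! h
    refine hsq i (Matrix.toLin'.injective ?_)
    ext1 x
    ext1
    simpa [pow_two] using h (Pi.single x 1)

theorem add_mem_anticommutingSizes {a b k l : ℕ} (hk : k ∈ anticommutingSizes a)
    (hl : l ∈ anticommutingSizes b) : k + l ∈ anticommutingSizes (a + b) := by
  obtain ⟨e, he, hesq⟩ := hk
  obtain ⟨g, hg, hgsq⟩ := hl
  have he' := isAnticommutingOn_toLin' he hesq Finset.univ
  have hg' := isAnticommutingOn_toLin' hg hgsq Finset.univ
  let f : Fin k ⊕ Fin l → End ℂ ((Fin a → ℂ) × (Fin b → ℂ)) :=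
    Sum.elim (fun i => (Matrix.toLin' (e i)).prodMap 0) (fun j =>
      LinearMap.prodMap 0 (Matrix.toLin' (g j)))
  have hf : IsAnticommutingOn f Finset.univ := by
    refine ⟨?_, ?_⟩
    · rintro (i | i) - (j | j) - hij ⟨x, y⟩
      · exact Prod.ext (he'.anticomm i (Finset.mem_univ _) j (Finset.mem_univ _)
          (fun h => hij (congrArg _ h)) x) (by simp [f])
      · simp [f]
      · simp [f]
      · exact Prod.ext (by simp [f]) (hg'.anticomm i (Finset.mem_univ _) j (Finset.mem_univ _)
          (fun h => hij (congrArg _ h)) y)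
    · rintro (i | i) -
      · obtain ⟨x, hx⟩ := he'.sq_ne_zero i (Finset.mem_univ _)
        exact ⟨(x, 0), fun h => hx (congrArg Prod.fst h)⟩
      · obtain ⟨x, hx⟩ := hg'.sq_ne_zero i (Finset.mem_univ _)
        exact ⟨(0, x), fun h => hx (congrArg Prod.snd h)⟩
  exact hf.card_mem_anticommutingSizes (by simp) (by simp)

theorem one_mem_anticommutingSizes_one : 1 ∈ anticommutingSizes 1 :=
  ⟨fun _ => 1, fun i j hij => (hij (Subsingleton.elim i j)).elim, fun _ => by simp⟩

theorem three_mem_anticommutingSizes_two : 3 ∈ anticommutingSizes 2 := by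
  refine ⟨![!![0, 1; 1, 0], !![0, 1; -1, 0], !![1, 0; 0, -1]], fun i j hij => ?_, fun i h => ?_⟩
  · fin_cases i <;> fin_cases j <;> first | exact (hij rfl).elim | simp
  · have h00 := congrFun (congrFun h 0) 0
    fin_cases i <;> simp [pow_two] at h00

/-- The coefficients of the rank-two nilpotent generators on `ℂ × (Fin m → ℂ) × ℂ`. -/
noncomputable def nilpotentGenerator {m : ℕ} (c d : ℂ) (i : Fin m) :
    End ℂ (ℂ × (Fin m → ℂ) × ℂ) where
  toFun p := (c * p.2.1 i, Pi.single i (d * p.2.2), 0)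
  map_add' p q := by simp [mul_add, Pi.single_add]
  map_smul' r p := by
    simp only [Prod.smul_snd, Prod.smul_fst, Pi.smul_apply, smul_eq_mul, RingHom.id_apply,
      Prod.smul_mk, mul_zero, ← Pi.single_smul, mul_left_comm]

/-- Generators with distinct `i` have product zero. For equal `i` the product of those with
coefficients `(c, d)` and `(c', d')` is `c * d'` times a fixed map from the last coordinate to the
first; the choices `(1, 1)` and `(-I, I)` make the two orders opposite and both squares nonzero. The
involution `g` anticommutes with all of them, since they exchange its eigenspaces. -/
theorem two_mul_add_one_mem_anticommutingSizes (m : ℕ) :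
    2 * m + 1 ∈ anticommutingSizes (m + 2) := by
  let g : End ℂ (ℂ × (Fin m → ℂ) × ℂ) :=
    LinearMap.prodMap 1 (LinearMap.prodMap (-1) 1)
  let e : Option (Fin m × Bool) → End ℂ (ℂ × (Fin m → ℂ) × ℂ)
    | none => g
    | some (i, true) => nilpotentGenerator 1 1 i
    | some (i, false) => nilpotentGenerator (-Complex.I) Complex.I i
  have he : IsAnticommutingOn e Finset.univ := by
    refine ⟨?_, ?_⟩
    · rintro (_ | ⟨i, _ | _⟩) - (_ | ⟨j, _ | _⟩) - hij ⟨x, y, z⟩ <;>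
        first
        | by_cases h : i = j <;>
          simp_all [e, g, nilpotentGenerator, eq_comm]
        | simp_all [e, g, nilpotentGenerator, ← Pi.single_neg]
    · rintro (_ | ⟨i, _ | _⟩) -
      · exact ⟨(1, 0, 0), by simp [e, g]⟩
      · exact ⟨(0, 0, 1), by simp [e, nilpotentGenerator]⟩
      · exact ⟨(0, 0, 1), by simp [e, nilpotentGenerator]⟩
  refine he.card_mem_anticommutingSizes ?_ ?_
  · simp; ring
  · simp; ring

theorem anticommutingBound_mem_anticommutingSizes {n : ℕ} (hn : 1 ≤ n) :
    anticommutingBound n ∈ anticommutingSizes n := by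
  by_cases h4 : n ≤ 4
  · interval_cases n
    · exact one_mem_anticommutingSizes_one
    · exact three_mem_anticommutingSizes_two
    · exact add_mem_anticommutingSizes three_mem_anticommutingSizes_two
        one_mem_anticommutingSizes_one
    · exact add_mem_anticommutingSizes three_mem_anticommutingSizes_two
        three_mem_anticommutingSizes_two
  · obtain ⟨m, rfl⟩ : ∃ m, n = m + 2 := ⟨n - 2, by omega⟩
    have h : anticommutingBound (m + 2) = 2 * m + 1 := by
      unfold anticommutingBound
      split_ifs <;> omega
    exact h ▸ two_mul_add_one_mem_anticommutingSizes m

end LowerBound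

theorem isGreatest_anticommutingBound {n : ℕ} (hn : 1 ≤ n) :
    IsGreatest (anticommutingSizes n) (anticommutingBound n) := by
  refine ⟨anticommutingBound_mem_anticommutingSizes hn, ?_⟩
  rintro k ⟨e, he, hsq⟩
  simpa using hasAnticommutingBound n (Fin n → ℂ) (fun i => Matrix.toLin' (e i)) Finset.univ
    (by simp) (isAnticommutingOn_toLin' he hsq Finset.univ)

theorem mainTheorem4 (n : ℕ) (hn : 1 ≤ n) :
    IsGreatest (anticommutingSizes n) (anticommutingAlpha n) ∧
      (anticommutingAlpha n : ℤ) =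
        if n ≤ 2 then 2 * (n : ℤ) - 1
        else if n ≤ 4 then 2 * (n : ℤ) - 2
        else 2 * (n : ℤ) - 3 := by
  have h := isGreatest_anticommutingBound hn
  have heq : anticommutingAlpha n = anticommutingBound n := h.csSup_eq
  rw [heq]
  refine ⟨h, ?_⟩
  unfold anticommutingBound
  split_ifs <;> omega
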